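/- **Theorem 4.1.** Let $\Gamma=(V,E)$ be a finite simple graph and $A(\Gamma)=\langle V\mid [v,w],\ (v,w)\in E\rangle$ its right-angled Artin group. A word in $V^{\pm1}$ is *reduced* if it cannot be shortened by successively applying the commutation relations and cancelling pairs $vv^{-1}$ or $v^{-1}v$; for $g\in A(\Gamma)$ let $|g|$ be the number of letters of a reduced spelling of $g$ and $\operatorname{supp}(g)\subseteq V$ the set of $v$ such that $v$ or $v^{-1}$ occurs in it. Let $\varphi\in\operatorname{Aut}(A(\Gamma))$ be *pure*, i.e. $s\in\operatorname{supp}(\varphi(s))$ for all $s\in V$, and a *square map*, i.e. whenever $(s_1,s_2)\in E$, every element of $\operatorname{supp}(\varphi(s_1))$ commutes in $A(\Gamma)$ with every element of $\operatorname{supp}(\varphi(s_2))$. Let $\mathcal D_\varphi$ be the directed graph on $V$ with an edge $s\to t$ whenever $s\neq t$ and $t\in\operatorname{supp}(\varphi(s))$. Let $\mathcal T_i$ ($i\ge 0$) be the set of vertices without outgoing edges in the subgraph of $\mathcal D_\varphi$ induced on $V\setminus\bigcup_{j<i}\mathcal T_j$, and let $G_{i}$ be the subgroup of $A(\Gamma)$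 generated by $\bigcup_{j\le i}\mathcal T_j$, with $G_{-1}=\{1\}$. Suppose that $\mathcal D_\varphi$ has no directed cycle (closed directed path of positive length, repeated vertices allowed). Then: 1. There is $k\ge 0$ with $\bigcup_{j\le k}\mathcal T_j=V$; let $h$, the *height* of the terminal partition $(\mathcal T_i)$, be the least such $k$. 2. If $V\ne\emptyset$, then $\varphi$ is a polynomially growing map: the limit $\lambda_\varphi(w)=\lim_{k\to\infty}\frac1k\log|\varphi^k(w)|$ exists for every $w\in A(\Gamma)$ (with $\lambda_\varphi(1):=0$), and there is a generator $s\in V$ with $\lambda_\varphi(s)=\max_{w}\lambda_\varphi(w)$ for which there are $n_0$, a constant $C$ and a polynomial $p$ with $|\varphi^n(s)|\le C\,p(n)$ for all $n>n_0$. 3. The degree of growth is at most $h$: there is a real polynomial $p$ of degree at most $h$ such that for every $w\in A(\Gamma)$ there is a constant $C>0$ with $|\varphi^n(w)|\le C\,p(n)$ for all $n\ge 0$. 4. For every $i\ge 0$ and every $s\in\mathcal T_i$ there are $t_0,t_1\in G_{i-1}$ and $\varepsilon\in\{1,-1\}$ with $\varphi(s)=t_0\,s^{\varepsilon}\,t_1$.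 -/

import Mathlib

open Filter Topology

namespace RAAG

/-- The defining relators `[v, w] = v w v⁻¹ w⁻¹`, one for each edge `(v, w)` of `Γ`. -/
def rels {V : Type*} (Γ : SimpleGraph V) : Set (FreeGroup V) :=
  {r | ∃ v w : V, Γ.Adj v w ∧ 
    r = FreeGroup.of v * FreeGroup.of w * (FreeGroup.of v)⁻¹ * (FreeGroup.of w)⁻¹}

/-- The right-angled Artin group `A(Γ) = ⟨V | [v, w], (v, w) ∈ E⟩`. -/
abbrev Artin {V : Type*} (Γ : SimpleGraph V) : Type _ :=
  PresentedGroup (rels Γ)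

/-- The standard generator of `A(Γ)` belonging to a vertex. -/
def gen {V : Type*} (Γ : SimpleGraph V) (v : V) : Artin Γ :=
  PresentedGroup.of v

/-- The element of `A(Γ)` spelled by a word; the letter `(v, true)` is `v`, and `(v, false)` is
`v⁻¹`. -/
def spell {V : Type*} (Γ : SimpleGraph V) (l : List (V × Bool)) : Artin Γ :=
  PresentedGroup.mk (rels Γ) (FreeGroup.mk l)

/-- One rewriting move on words: apply a commutation relation to two consecutive letters, or cancel
a pair `v v⁻¹` or `v⁻¹ v`. -/
inductive Move {V : Type*} (Γ : SimpleGraph V) : List (V × Bool) → List (V × Bool) → Prop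
  | swap (l₁ l₂ : List (V × Bool)) (u v : V) (a b : Bool) (h : Γ.Adj u v) :
      Move Γ (l₁ ++ (u, a) :: (v, b) :: l₂) (l₁ ++ (v, b) :: (u, a) :: l₂)
  | cancel (l₁ l₂ : List (V × Bool)) (v : V) (a : Bool) :
      Move Γ (l₁ ++ (v, a) :: (v, !a) :: l₂) (l₁ ++ l₂)

/-- A word is reduced if it cannot be shortened by successive moves. -/
def IsReduced {V : Type*} (Γ : SimpleGraph V) (l : List (V × Bool)) : Prop :=
  ∀ l' : List (V × Bool), Relation.ReflTransGen (Move Γ) l l' → l.length ≤ l'.length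

/-- The length `|g|`: the number of letters of a reduced spelling of `g`. (All reduced spellings of
`g` have the same number of letters.) -/
noncomputable def length {V : Type*} (Γ : SimpleGraph V) (g : Artin Γ) : ℕ :=
  sInf {n : ℕ | ∃ l : List (V × Bool), IsReduced Γ l ∧ spell Γ l = g ∧ l.length = n}

/-- The support of `g`: the vertices `v` such that `v` or `v⁻¹` occurs in a reduced spelling of
`g`. (All reduced spellings of `g` have the same letters.) -/
def supp {V : Type*} (Γ : SimpleGraph V) (g : Artin Γ) : Set V :=
  {v | ∃ l : List (V × Bool), IsReduced Γ l ∧ spell Γ l = g ∧ ∃ a : Bool, (v, a) ∈ l}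

/-- `φ` is pure: every generator occurs in its own image. -/
def IsPure {V : Type*} (Γ : SimpleGraph V) (φ : MulAut (Artin Γ)) : Prop :=
  ∀ s : V, s ∈ supp Γ (φ (gen Γ s))

/-- `φ` is a square map: if two (distinct) generators commute, that is, span an edge, then every
vertex of the support of the image of the first one commutes with every vertex of the support of
the image of the second one. -/
def IsSquare {V : Type*} (Γ : SimpleGraph V) (φ : MulAut (Artin Γ)) : Prop :=
  ∀ s₁ s₂ : V, Γ.Adj s₁ s₂ → ∀ u ∈ supp Γ (φ (gen Γ s₁)), ∀ v ∈ supp Γ (φ (gen Γ s₂)),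
    Commute (gen Γ u) (gen Γ v)

/-- The automorphism diagram: an edge from `s` to `t ≠ s` whenever `t ∈ supp (φ s)`. -/
def diagram {V : Type*} (Γ : SimpleGraph V) (φ : MulAut (Artin Γ)) : Digraph V where
  Adj s t := s ≠ t ∧ t ∈ supp Γ (φ (gen Γ s))

/-- No directed closed path of positive length (vertices may be repeated). -/
def NoCycle {V : Type*} (D : Digraph V) : Prop :=
  ∀ s : V, ¬ Relation.TransGen D.Adj s s

/-- The terminal vertices of the subgraph of `D` induced on `S`: those without an outgoing edge. -/
def terminalIn {V : Type*} (D : Digraph V) (S : Set V) : Set V :=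
  {s | s ∈ S ∧ ∀ t ∈ S, ¬ D.Adj s t}

/-- The union `𝒯₀ ∪ ⋯ ∪ 𝒯ᵢ₋₁` of the first `i` levels of the terminal partition. -/
def below {V : Type*} (D : Digraph V) : ℕ → Set V
  | 0 => ∅
  | i + 1 => below D i ∪ terminalIn D (below D i)ᶜ

/-- The level `𝒯ᵢ` of the terminal partition: the terminal vertices of what remains of `D` when
`𝒯₀, …, 𝒯ᵢ₋₁` have been removed. -/
def level {V : Type*} (D : Digraph V) (i : ℕ) : Set V :=
  terminalIn D (below D i)ᶜ

theorem below_eq_iUnion {V : Type*} (D : Digraph V) (i : ℕ) :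
    below D i = {s | ∃ j < i, s ∈ level D j} := by
  induction i with
  | zero => ext s; simp [below]
  | succ i ih =>
    have h : below D (i + 1) = below D i ∪ level D i := rfl
    rw [h, ih]
    ext s
    simp only [Set.mem_union, Set.mem_ofPred_eq, Nat.lt_succ_iff_lt_or_eq]
    constructor
    · rintro (⟨j, hj, hs⟩ | hs)
      · exact ⟨j, Or.inl hj, hs⟩
      · exact ⟨i, Or.inr rfl, hs⟩
    · rintro ⟨j, hj | rfl, hs⟩
      · exact Or.inl ⟨j, hj, hs⟩
      · exact Or.inr hs

/-- The height of the terminal partition: the least `k` with `𝒯₀ ∪ ⋯ ∪ 𝒯ₖ = V`. -/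
noncomputable def height {V : Type*} (D : Digraph V) : ℕ :=
  sInf {k : ℕ | below D (k + 1) = Set.univ}

/-- The subgroup `Gᵢ₋₁` generated by `𝒯₀ ∪ ⋯ ∪ 𝒯ᵢ₋₁` (trivial for `i = 0`). -/
def lower {V : Type*} (Γ : SimpleGraph V) (D : Digraph V) (i : ℕ) : Subgroup (Artin Γ) :=
  Subgroup.closure (gen Γ '' below D i)

/-- The dilatation of `φ` at `w` exists and equals `l`. -/
def HasDilatationAt {V : Type*} (Γ : SimpleGraph V) (φ : MulAut (Artin Γ)) (w : Artin Γ)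
    (l : ℝ) : Prop :=
  Tendsto (fun k : ℕ => Real.log (length Γ ((φ ^ k) w)) / k) atTop (𝓝 l)

/-- The generator `s` realizes the dilatation of `φ`: all dilatations exist, and the one at `s`
is the largest. (The trivial word counts with dilatation `0`, which does not affect the
maximum, because a generator has positive length under all powers of `φ`.) -/
def RealizesDilatation {V : Type*} (Γ : SimpleGraph V) (φ : MulAut (Artin Γ)) (s : V) : Prop :=
  ∃ l : ℝ, HasDilatationAt Γ φ (gen Γ s) l ∧
    ∀ w : Artin Γ, ∃ l' ≤ l, HasDilatationAt Γ φ w l'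

/-- The word `w` grows polynomially under iterations of `φ`. -/
def GrowsPolynomially {V : Type*} (Γ : SimpleGraph V) (φ : MulAut (Artin Γ)) (w : Artin Γ) :
    Prop :=
  ∃ (n₀ : ℕ) (C : ℝ) (p : Polynomial ℝ), ∀ n : ℕ, n₀ < n →
    (length Γ ((φ ^ n) w) : ℝ) ≤ C * p.eval (n : ℝ)

/-- `φ` is polynomially growing: a generator that realizes the dilatation grows polynomially. -/
def IsPolynomiallyGrowing {V : Type*} (Γ : SimpleGraph V) (φ : MulAut (Artin Γ)) : Prop :=
  ∃ s : V, RealizesDilatation Γ φ s ∧ GrowsPolynomially Γ φ (gen Γ s)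

end RAAG

/-!
An acyclic diagram makes `φ` triangular with respect to the terminal partition: the image of a
generator `t` of level `i` is spelled by `t` and by generators of lower levels. The claim about the
growth then follows once `t` is known to occur exactly once, `φ t = t₀ t^{±1} t₁` with `t₀`, `t₁` in
the subgroup generated by the lower levels: the length of `φⁿ t` increases at step `n` by at most
`|φⁿ t₀| + |φⁿ t₁|`, so each level raises the degree of growth by at most one
(`RAAG.special_below_le_boundedBy`), and all dilatations are `0`.

To see that `t` occurs only once, let `S` be the set of vertices of lower levels, and suppose that
every generator in `S` lies in the image under `φ` of the subgroup generated by `S`; this holds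
inductively, since the single occurrence of the generators of a level allows one to solve for them
(`RAAG.special_below_le_map`). As `φ` is a pure square map, `φ` sends the neighbours of `t` to
elements commuting with `t`, so there is an endomorphism `σ` that agrees with `φ` on `S` and fixes
`t`. Now `Ψ = σ ∘ φ⁻¹` fixes the generators in `S` and sends `w = φ t` to `t`. By the square property
again, letters of `w` that are adjacent to `t` commute with all letters of `w`; dividing them out
leaves a free product `H * ⟨t⟩`, on which `Ψ` induces an endomorphism that is the identity on `H`
and takes the value `t` at the image of `w`
(`RAAG.exists_eq_mul_zpow_mul_of_map_eq_gen`).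

It remains to show for a group `H` that such an endomorphism of `H * ⟨t⟩` takes the value `t` only
at elements `h t^{±1} k` (`AdjoinLetter.exists_eq_of_mul_zpow_mul_of`). Up to factors in `H`, the
image `x` of `t` begins and ends with a letter `t^{±1}`. Its exponent sum is not zero, so its nonzero
powers do not get shorter than `x` (`AdjoinLetter.Alternating.pow`), and in a product of such powers
separated by nontrivial elements of `H` nothing cancels. Therefore `t` can only be a value if `x` has
just one letter `t^{±1}`, and then the endomorphism is invertible and the claim is clear.
-/

/-! ### Endomorphisms of a free product `H * ⟨t⟩` that fix `H` -/

/-- The free product of `H` with an infinite cyclic group, encoded as the HNN extension of `H` over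
the trivial subgroup; its stable letter generates the cyclic factor. -/
abbrev AdjoinLetter (H : Type*) [Group H] : Type _ :=
  HNNExtension H ⊥ ⊥ (MulEquiv.refl (⊥ : Subgroup H))

namespace AdjoinLetter

open HNNExtension

variable {H : Type*} [Group H]

/-- The homomorphism out of `H * ⟨t⟩` with prescribed restriction to `H` and image of `t`. -/
noncomputable def extend {M : Type*} [Group M] (f : H →* M) (x : M) : AdjoinLetter H →* M :=
  HNNExtension.lift f x fun a => by
    obtain ⟨a, ha⟩ := a
    obtain rfl : a = 1 := ha
    simp

@[simp]
theorem extend_of {M : Type*} [Group M] (f : H →* M) (x : M) (h : H) :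
    extend f x (of h) = f h :=
  lift_of ..

@[simp]
theorem extend_t {M : Type*} [Group M] (f : H →* M) (x : M) : extend f x t = x :=
  lift_t ..

/-- The exponent sum of the letter `t`. -/
noncomputable def exponent : AdjoinLetter H →* Multiplicative ℤ :=
  extend 1 (Multiplicative.ofAdd 1)

@[simp]
theorem exponent_of (h : H) : exponent (of h) = 1 := by simp [exponent]

@[simp]
theorem exponent_t : exponent (t : AdjoinLetter H) = Multiplicative.ofAdd 1 := by simp [exponent]

/-- `Alternating a b n x` says that `x = t^a h₁ t^{a₂} h₂ ⋯ h_{n-1} t^b` with `n` letters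
`t^{±1}`, no two of which cancel: `hᵢ = 1` only between letters of the same sign. -/
inductive Alternating : ℤˣ → ℤˣ → ℕ → AdjoinLetter H → Prop
  | letter (a : ℤˣ) : Alternating a a 1 (t ^ (a : ℤ))
  | append {a b c d : ℤˣ} {m n : ℕ} {x y : AdjoinLetter H} (h : H) :
      Alternating a b m x → Alternating c d n y → (h = 1 → b = c) →
      Alternating a d (m + n) (x * of h * y)

namespace Alternating

theorem pos {a b : ℤˣ} {n : ℕ} {x : AdjoinLetter H} (hx : Alternating a b n x) : 0 < n := by
  induction hx <;> omega

theorem inv {a b : ℤˣ} {n : ℕ} {x : AdjoinLetter H} (hx : Alternating a b n x) :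
    Alternating (-b) (-a) n x⁻¹ := by
  induction hx with
  | letter a => simpa using letter (H := H) (-a)
  | append h _ _ hh hx hy =>
    have := append h⁻¹ hy hx (fun h1 => by rw [hh (by simpa using h1)])
    rw [add_comm]
    simpa [mul_assoc] using this

/-- An alternating element times `h` is the value of a reduced word of the HNN extension, in which
each letter `t^{±1}` is paired with the element of `H` that follows it. -/
theorem exists_list {a b : ℤˣ} {n : ℕ} {x : AdjoinLetter H} (hx : Alternating a b n x) (h : H) :
    ∃ l : List (ℤˣ × H), l.IsChain (fun p q => p.2 ∈ toSubgroup (⊥ : Subgroup H) ⊥ p.1 → p.1 = q.1) ∧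
      l.length = n ∧ l.head?.map Prod.fst = some a ∧ l.getLast? = some (b, h) ∧
      (l.map fun p => (t ^ (p.1 : ℤ) * of p.2 : AdjoinLetter H)).prod = x * of h := by
  induction hx generalizing h with
  | letter a => exact ⟨[(a, h)], by simp⟩
  | append g _ _ hg hx hy =>
    obtain ⟨l, hc, hl, hf, hb, hp⟩ := hx g
    obtain ⟨l', hc', hl', hf', hb', hp'⟩ := hy h
    refine ⟨l ++ l', List.isChain_append.2 ⟨hc, hc', ?_⟩, by simp [hl, hl'], ?_, ?_, ?_⟩
    · intro p hp q hq hmem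
      obtain rfl : (_, g) = p := by simpa [hb] using hp
      have hg1 : g = 1 := by
        simp only [toSubgroup] at hmem
        split_ifs at hmem <;> simpa using hmem
      rw [Option.mem_def] at hq
      simp only [hq, Option.map_some, Option.some.injEq] at hf'
      rw [hf', ← hg hg1]
    · cases l <;> simp_all
    · simp [hb']
    · simp [hp, hp', mul_assoc]

/-- By Britton's lemma the number of letters `t^{±1}` in an alternating expression is determined by
its value. -/
theorem eq_one_of_eq_t {a b : ℤˣ} {n : ℕ} {x : AdjoinLetter H} (hx : Alternating a b n x)
    {h k : H} (ht : of h * x * of k = t) : n = 1 := by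
  obtain ⟨l, hc, hl, -, -, hp⟩ := hx.exists_list k
  have key := ReducedWord.map_fst_eq_and_of_prod_eq (φ := MulEquiv.refl (⊥ : Subgroup H))
    (w₁ := ⟨h, l, hc⟩) (w₂ := ⟨1, [(1, 1)], by simp⟩)
    (by rw [NormalWord.ReducedWord.prod, NormalWord.ReducedWord.prod, hp, ← mul_assoc, ht]; simp)
  simpa [hl] using congrArg List.length key.1

theorem cons_decomposition {a b : ℤˣ} {n : ℕ} {x : AdjoinLetter H} (hx : Alternating a b n x) :
    (n = 1 ∧ a = b ∧ x = t ^ (a : ℤ)) ∨ ∃ (h : H) (c : ℤˣ) (m : ℕ) (y : AdjoinLetter H),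
      n = m + 1 ∧ Alternating c b m y ∧ (h = 1 → a = c) ∧ x = t ^ (a : ℤ) * of h * y := by
  induction hx with
  | letter a => exact Or.inl ⟨rfl, rfl, rfl⟩
  | append h _ hy hh ihx _ =>
    right
    obtain ⟨rfl, rfl, rfl⟩ | ⟨g, c', m', z, rfl, hz, hg, rfl⟩ := ihx
    · exact ⟨h, _, _, _, add_comm _ _, hy, hh, rfl⟩
    · exact ⟨g, c', _, _, by omega, append h hz hy hh, hg, by simp [mul_assoc]⟩

theorem snoc_decomposition {a b : ℤˣ} {n : ℕ} {x : AdjoinLetter H} (hx : Alternating a b n x) :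
    (n = 1 ∧ a = b ∧ x = t ^ (a : ℤ)) ∨ ∃ (h : H) (c : ℤˣ) (m : ℕ) (y : AdjoinLetter H),
      n = m + 1 ∧ Alternating a c m y ∧ (h = 1 → c = b) ∧ x = y * of h * t ^ (b : ℤ) := by
  obtain ⟨hn, hab, h⟩ | ⟨h, c, m, y, hn, hy, hh, h'⟩ := hx.inv.cons_decomposition
  · rw [neg_inj] at hab
    subst hab
    exact Or.inl ⟨hn, rfl, by rw [← inv_inj, h]; simp⟩
  · refine Or.inr ⟨h⁻¹, -c, m, y⁻¹, hn, by simpa using hy.inv, fun h1 => ?_, ?_⟩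
    · rw [← hh (by simpa using h1), neg_neg]
    · rw [← inv_inj, h']; simp [mul_assoc]

/-- Positive powers of an alternating element with nonzero exponent sum begin and end as the element
does, and are no shorter. -/
theorem pow {n : ℕ} : ∀ {a b : ℤˣ} {x : AdjoinLetter H}, Alternating a b n x → exponent x ≠ 1 →
    ∀ j : ℕ, ∃ N, n ≤ N ∧ Alternating a b N (x ^ (j + 1)) := by
  induction n using Nat.strong_induction_on with
  | _ n ih =>
  intro a b x hx hexp j
  by_cases hab : b = a
  · -- No cancellation occurs at the junctions of `x ⋯ x`.
    induction j with
    | zero => exact ⟨n, le_rfl, by simpa using hx⟩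
    | succ j ihj =>
      obtain ⟨N, hN, h⟩ := ihj
      exact ⟨N + n, by omega, by simpa [pow_succ _ (j + 1)] using append 1 h hx fun _ => hab⟩
  · -- Here `x = t^a h z k t^{-a}`, and the powers of `h z k` are governed by those of `z` if
    -- `k h = 1`, and involve no cancellation otherwise.
    obtain ⟨-, h, -⟩ | ⟨h, c, m, y, rfl, hy, hh, rfl⟩ := hx.cons_decomposition
    · exact absurd h.symm hab
    have hba : (b : ℤ) = -(a : ℤ) := by
      rcases Int.units_eq_one_or a with rfl | rfl <;>
        rcases Int.units_eq_one_or b with rfl | rfl <;> simp_all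
    obtain ⟨-, rfl, rfl⟩ | ⟨k, d, m, z, rfl, hz, hk, rfl⟩ := hy.snoc_decomposition
    · simp [hba] at hexp
    have hexpz : exponent z ≠ 1 := by
      intro h1
      simp [hba, h1] at hexp
    have hinner : ∃ N Z, m ≤ N ∧ Alternating c d N Z ∧
        (of h * z * of k) ^ (j + 1) = of h * Z * of k := by
      by_cases hkh : k * h = 1
      · obtain ⟨N, hN, hZ⟩ := ih m (by omega) hz hexpz j
        refine ⟨N, _, hN, hZ, ?_⟩
        obtain rfl : k = h⁻¹ := eq_inv_of_mul_eq_one_left hkh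
        rw [map_inv, conj_pow]
      · clear hexp
        induction j with
        | zero => exact ⟨m, z, le_rfl, hz, by simp⟩
        | succ j ihj =>
          obtain ⟨N, Z, hN, hZ, he⟩ := ihj
          exact ⟨N + m, _, by omega, append (k * h) hZ hz fun h1 => absurd h1 hkh, by
            rw [pow_succ, he]; simp [mul_assoc]⟩
    obtain ⟨N, Z, hN, hZ, he⟩ := hinner
    refine ⟨1 + N + 1, by omega, ?_⟩
    have hconj : (t ^ (a : ℤ) * of h * (z * of k * t ^ (b : ℤ)) : AdjoinLetter H) =
        t ^ (a : ℤ) * (of h * z * of k) * (t ^ (a : ℤ))⁻¹ := by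
      rw [hba, zpow_neg]; simp only [mul_assoc]
    have := append k (append h (letter a) hZ hh) (letter b) hk
    rw [hconj, conj_pow, he, ← zpow_neg, ← hba]
    simpa [mul_assoc] using this

theorem zpow {n : ℕ} {a b : ℤˣ} {x : AdjoinLetter H} (hx : Alternating a b n x)
    (hexp : exponent x ≠ 1) {j : ℤ} (hj : j ≠ 0) :
    ∃ N a' b', n ≤ N ∧ Alternating a' b' N (x ^ j) := by
  obtain ⟨i, rfl | rfl⟩ := j.eq_nat_or_neg
  · obtain ⟨i, rfl⟩ := Nat.exists_eq_succ_of_ne_zero (by simpa using hj)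
    obtain ⟨N, hN, h⟩ := hx.pow hexp i
    exact ⟨N, _, _, hN, by exact_mod_cast h⟩
  · obtain ⟨i, rfl⟩ := Nat.exists_eq_succ_of_ne_zero (by simpa using hj)
    obtain ⟨N, hN, h⟩ := hx.pow hexp i
    refine ⟨N, -b, -a, hN, ?_⟩
    rw [zpow_neg, zpow_natCast]
    exact h.inv

end Alternating

/-- The elements `t^{j₁} h₁ t^{j₂} ⋯ h_{r-1} t^{jᵣ}` with `r ≥ 1`, all `jᵢ ≠ 0` and all
`hᵢ ≠ 1`. -/
inductive Syllables : AdjoinLetter H → Prop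
  | zpow {j : ℤ} (hj : j ≠ 0) : Syllables (t ^ j)
  | cons {j : ℤ} {h : H} {x : AdjoinLetter H} (hj : j ≠ 0) (hh : h ≠ 1) (hx : Syllables x) :
      Syllables (t ^ j * of h * x)

theorem exists_syllables_zpow_mul {x : AdjoinLetter H} (hx : Syllables x) (ε : ℤ) :
    (∃ h, t ^ ε * x = of h) ∨ ∃ h y, Syllables y ∧ t ^ ε * x = of h * y := by
  cases hx with
  | @zpow j hj =>
    rw [← zpow_add]
    by_cases h : ε + j = 0
    · exact Or.inl ⟨1, by simp [h]⟩
    · exact Or.inr ⟨1, _, .zpow h, by simp⟩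
  | @cons j h y hj hh hy =>
    right
    rw [← mul_assoc, ← mul_assoc, ← zpow_add]
    by_cases h0 : ε + j = 0
    · exact ⟨h, y, hy, by simp [h0]⟩
    · exact ⟨1, _, .cons h0 hh hy, by simp⟩

theorem mem_or_exists_syllables (g : AdjoinLetter H) :
    (∃ h, g = of h) ∨ ∃ h x k, Syllables x ∧ g = of h * x * of k := by
  suffices hmul : ∀ g x : AdjoinLetter H, ((∃ h, x = of h) ∨ ∃ h y k, Syllables y ∧
      x = of h * y * of k) → ((∃ h, g * x = of h) ∨ ∃ h y k, Syllables y ∧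
      g * x = of h * y * of k) by
    simpa using hmul g 1 (Or.inl ⟨1, by simp⟩)
  have hmult : ∀ (j : ℤ) (x : AdjoinLetter H), j ≠ 0 → ((∃ h, x = of h) ∨ ∃ h y k, Syllables y ∧
      x = of h * y * of k) → ((∃ h, t ^ j * x = of h) ∨ ∃ h y k, Syllables y ∧
      t ^ j * x = of h * y * of k) := by
    rintro j x hj (⟨h, rfl⟩ | ⟨h, y, k, hy, rfl⟩)
    · exact Or.inr ⟨1, _, h, .zpow hj, by simp⟩
    · by_cases hh : h = 1
      · subst hh
        obtain ⟨g, hg⟩ | ⟨g, z, hz, hg⟩ := exists_syllables_zpow_mul hy j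
        · exact Or.inl ⟨g * k, by simp [← mul_assoc, hg]⟩
        · exact Or.inr ⟨g, z, k, hz, by simp [← mul_assoc, hg]⟩
      · exact Or.inr ⟨1, _, k, .cons hj hh hy, by simp [mul_assoc]⟩
  intro g x hx
  have hg : g ∈ Subgroup.closure (Set.range (of : H → AdjoinLetter H) ∪ {t}) := by
    induction g using HNNExtension.induction_on with
    | of h => exact Subgroup.subset_closure (Or.inl ⟨h, rfl⟩)
    | t => exact Subgroup.subset_closure (Or.inr rfl)
    | mul _ _ hx hy => exact mul_mem hx hy
    | inv _ hx => exact inv_mem hx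
  have hofm : ∀ (g : H) (x : AdjoinLetter H), ((∃ h, x = of h) ∨ ∃ h y k, Syllables y ∧
      x = of h * y * of k) → ((∃ h, of g * x = of h) ∨ ∃ h y k, Syllables y ∧
      of g * x = of h * y * of k) := by
    rintro g x (⟨h, rfl⟩ | ⟨h, y, k, hy, rfl⟩)
    · exact Or.inl ⟨g * h, by simp⟩
    · exact Or.inr ⟨g * h, y, k, hy, by simp [mul_assoc]⟩
  induction hg using Subgroup.closure_induction_left with
  | one => simpa using hx
  | mul_left u hu v _ ih =>
    rw [mul_assoc]
    obtain ⟨h, rfl⟩ | rfl := hu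
    · exact hofm h _ ih
    · simpa using hmult 1 _ one_ne_zero ih
  | inv_mul_cancel u hu v _ ih =>
    rw [mul_assoc]
    obtain ⟨h, rfl⟩ | rfl := hu
    · simpa using hofm h⁻¹ _ ih
    · simpa using hmult (-1) _ (by simp) ih

theorem Syllables.exists_alternating {x : AdjoinLetter H} (hx : Syllables x) :
    ∃ a b n, Alternating a b n x := by
  have hpow : ∀ j : ℤ, j ≠ 0 → ∃ a b n, Alternating a b n (t ^ j : AdjoinLetter H) := by
    intro j hj
    obtain ⟨N, a, b, -, h⟩ := (Alternating.letter (H := H) 1).zpow (by simp) hj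
    exact ⟨a, b, N, by simpa using h⟩
  induction hx with
  | zpow hj => exact hpow _ hj
  | cons hj hh _ ih =>
    obtain ⟨a, b, n, h⟩ := hpow _ hj
    obtain ⟨a', b', n', h'⟩ := ih
    exact ⟨_, _, _, h.append _ h' fun h1 => absurd h1 hh⟩

/-- Substituting an alternating element of nonzero exponent sum for `t` does not shorten. -/
theorem Syllables.exists_alternating_map {x y : AdjoinLetter H} (hy : Syllables y) {a b : ℤˣ}
    {n : ℕ} (hx : Alternating a b n x) (hexp : exponent x ≠ 1) :
    ∃ a' b' N, n ≤ N ∧ Alternating a' b' N (extend of x y) := by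
  induction hy with
  | zpow hj =>
    obtain ⟨N, a', b', hN, h⟩ := hx.zpow hexp hj
    exact ⟨a', b', N, hN, by simpa using h⟩
  | cons hj hh _ ih =>
    obtain ⟨N, a', b', hN, h⟩ := hx.zpow hexp hj
    obtain ⟨c', d', N', hN', h'⟩ := ih
    exact ⟨a', d', N + N', by omega, by simpa using h.append _ h' fun h1 => absurd h1 hh⟩

theorem exponent_extend (x y : AdjoinLetter H) :
    Multiplicative.toAdd (exponent (extend of x y)) =
      Multiplicative.toAdd (exponent x) * Multiplicative.toAdd (exponent y) := by
  induction y using HNNExtension.induction_on with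
  | of h => simp
  | t => simp
  | mul y z hy hz => simp [hy, hz, mul_add]
  | inv y hy => simp [hy]

/-- If an endomorphism of `H * ⟨t⟩` that is the identity on `H` takes the value `t` at `y`, then
`y` is `t` or `t⁻¹` up to factors in `H` on both sides. -/
theorem exists_eq_of_mul_zpow_mul_of {x y : AdjoinLetter H} (hy : extend of x y = t) :
    ∃ (h k : H) (ε : ℤ), (ε = 1 ∨ ε = -1) ∧ y = of h * t ^ ε * of k := by
  have hexp : exponent x ≠ 1 := by
    intro h
    have := exponent_extend x y
    simp [hy, h] at this
  obtain ⟨h, rfl⟩ | ⟨h, x, k, hx, rfl⟩ := mem_or_exists_syllables x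
  · simp at hexp
  replace hexp : exponent x ≠ 1 := by simpa using hexp
  obtain ⟨a, b, n, hx⟩ := hx.exists_alternating
  -- Normalize the image of `t` by precomposing with the automorphism `t ↦ h t k`.
  have hcomp : (extend of (of h * x * of k) : AdjoinLetter H →* AdjoinLetter H) =
      (extend of x).comp (extend of (of h * t * of k)) :=
    HNNExtension.hom_ext (by ext; simp) (by simp)
  have hinv : ∀ z : AdjoinLetter H,
      extend of (of h⁻¹ * t * of k⁻¹) (extend of (of h * t * of k) z) = z := by
    intro z
    have : ((extend of (of h⁻¹ * t * of k⁻¹) : AdjoinLetter H →* AdjoinLetter H).comp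
        (extend of (of h * t * of k))) = MonoidHom.id _ :=
      HNNExtension.hom_ext (by ext; simp) (by simp [mul_assoc])
    exact DFunLike.congr_fun this z
  rw [hcomp, MonoidHom.comp_apply] at hy
  rw [← hinv y]
  generalize extend of (of h * t * of k) y = z at hy
  -- A reduced expression of `t` has only one letter, so `x` has only one letter.
  have hxt : x = t ^ (a : ℤ) := by
    obtain ⟨g, rfl⟩ | ⟨g, z, g', hz, rfl⟩ := mem_or_exists_syllables z
    · have := congrArg (Multiplicative.toAdd ∘ exponent) hy
      simp at this
    · obtain ⟨a', b', N, hN, hA⟩ := hz.exists_alternating_map hx hexp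
      have h1 : N = 1 := hA.eq_one_of_eq_t (h := g) (k := g') (by simpa using hy)
      have hpos := hx.pos
      obtain ⟨-, -, h⟩ | ⟨_, _, _, _, rfl, hw, -, -⟩ := hx.cons_decomposition
      · exact h
      · have := hw.pos
        omega
  subst hxt
  have hinvol : ((extend of (t ^ (a : ℤ)) : AdjoinLetter H →* AdjoinLetter H).comp
      (extend of (t ^ (a : ℤ)))) = MonoidHom.id _ :=
    HNNExtension.hom_ext (by ext; simp) (by
      rcases Int.units_eq_one_or a with rfl | rfl <;> simp)
  have hz : z = t ^ (a : ℤ) := by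
    simpa [hy] using (DFunLike.congr_fun hinvol z).symm
  rcases Int.units_eq_one_or a with rfl | rfl
  · exact ⟨h⁻¹, k⁻¹, 1, Or.inl rfl, by simp [hz]⟩
  · exact ⟨k, h, -1, Or.inr rfl, by simp [hz, mul_assoc]⟩

end AdjoinLetter

namespace RAAG

variable {V : Type*} {Γ : SimpleGraph V}

/-! ### Right-angled Artin groups: homomorphisms, spellings and lengths -/

/-- The homomorphism out of `A(Γ)` with prescribed values on the generators. -/
def lift {M : Type*} [Group M] (f : V → M) (hf : ∀ v w, Γ.Adj v w → Commute (f v) (f w)) :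
    Artin Γ →* M :=
  PresentedGroup.toGroup (f := f) (by
    rintro r ⟨v, w, h, rfl⟩
    simp [(hf v w h).eq])

@[simp]
theorem lift_gen {M : Type*} [Group M] (f : V → M)
    (hf : ∀ v w, Γ.Adj v w → Commute (f v) (f w)) (v : V) : lift f hf (gen Γ v) = f v :=
  PresentedGroup.toGroup.of _

theorem hom_ext {M : Type*} [Group M] {f g : Artin Γ →* M}
    (h : ∀ v, f (gen Γ v) = g (gen Γ v)) : f = g :=
  PresentedGroup.ext h

theorem commute_gen {v w : V} (h : Γ.Adj v w) : Commute (gen Γ v) (gen Γ w) := by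
  have : PresentedGroup.mk (rels Γ) _ = 1 := PresentedGroup.one_of_mem ⟨v, w, h, rfl⟩
  simp only [map_mul, map_inv] at this
  exact commutatorElement_eq_one_iff_commute.1 this

theorem spell_nil : spell Γ [] = 1 :=
  map_one _

theorem spell_append (l l' : List (V × Bool)) : spell Γ (l ++ l') = spell Γ l * spell Γ l' := by
  simp only [spell, ← FreeGroup.mul_mk, map_mul]

theorem spell_invRev (l : List (V × Bool)) : spell Γ (FreeGroup.invRev l) = (spell Γ l)⁻¹ := by
  simp only [spell, ← FreeGroup.inv_mk, map_inv]

theorem spell_singleton (v : V) (a : Bool) :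
    spell Γ [(v, a)] = if a then gen Γ v else (gen Γ v)⁻¹ := by
  cases a
  · exact spell_invRev (Γ := Γ) [(v, true)]
  · rfl

theorem spell_cons (p : V × Bool) (l : List (V × Bool)) :
    spell Γ (p :: l) = spell Γ [p] * spell Γ l :=
  spell_append [p] l

theorem spell_surjective : Function.Surjective (spell Γ) := by
  intro g
  obtain ⟨x, rfl⟩ := PresentedGroup.mk_surjective _ g
  induction x using Quot.inductionOn with
  | _ l => exact ⟨l, rfl⟩

theorem Move.spell_eq {l l' : List (V × Bool)} (h : Move Γ l l') : spell Γ l = spell Γ l' := by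
  cases h with
  | swap l₁ l₂ u v a b h =>
    have hc : Commute (spell Γ [(u, a)]) (spell Γ [(v, b)]) := by
      have := commute_gen h
      cases a <;> cases b <;> simp [spell_singleton, this]
    rw [spell_append, spell_append, spell_cons (u, a) (_ :: _), spell_cons (v, b) l₂,
      spell_cons (v, b) (_ :: _), spell_cons (u, a) l₂, hc.left_comm]
  | cancel l₁ l₂ v a =>
    rw [spell_append, spell_append, spell_cons (v, a) (_ :: _), spell_cons (v, !a) l₂]
    cases a <;> simp [spell_singleton]

/-- Every word can be reduced. Uniqueness of the result is not needed: upper bounds for lengths come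
from arbitrary spellings. -/
theorem exists_isReduced (l : List (V × Bool)) :
    ∃ l', IsReduced Γ l' ∧ spell Γ l' = spell Γ l ∧ l'.length ≤ l.length := by
  obtain ⟨l', hl', hmin⟩ := (measure (List.length (α := V × Bool))).wf.has_min
    {l' | Relation.ReflTransGen (Move Γ) l l'} ⟨l, .refl⟩
  refine ⟨l', fun m hm => not_lt.1 (hmin m (Relation.ReflTransGen.trans hl' hm)), ?_,
    not_lt.1 (hmin l .refl)⟩
  clear hmin
  induction hl' with
  | refl => rfl
  | tail _ h ih => rw [← h.spell_eq, ih]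

theorem length_spell_le (l : List (V × Bool)) : length Γ (spell Γ l) ≤ l.length := by
  obtain ⟨l', hr, hs, hl⟩ := exists_isReduced (Γ := Γ) l
  have hle : length Γ (spell Γ l) ≤ l'.length := Nat.sInf_le (by exact ⟨l', hr, hs, rfl⟩)
  exact hle.trans hl

theorem exists_isReduced_spell_eq (g : Artin Γ) :
    ∃ l, IsReduced Γ l ∧ spell Γ l = g ∧ l.length = length Γ g := by
  obtain ⟨l, rfl⟩ := spell_surjective g
  obtain ⟨l', hr, hs, -⟩ := exists_isReduced (Γ := Γ) l
  exact Nat.sInf_mem (s := {n | ∃ m, IsReduced Γ m ∧ spell Γ m = spell Γ l ∧ m.length = n})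
    ⟨_, l', hr, hs, rfl⟩

theorem length_one : length Γ 1 = 0 := by
  simpa [spell_nil] using length_spell_le (Γ := Γ) []

theorem length_gen_le (v : V) : length Γ (gen Γ v) ≤ 1 :=
  length_spell_le [(v, true)]

theorem length_mul_le (g h : Artin Γ) : length Γ (g * h) ≤ length Γ g + length Γ h := by
  obtain ⟨l, -, rfl, hl⟩ := exists_isReduced_spell_eq g
  obtain ⟨l', -, rfl, hl'⟩ := exists_isReduced_spell_eq h
  rw [← spell_append, ← hl, ← hl', ← List.length_append]
  exact length_spell_le _

theorem length_inv_le (g : Artin Γ) : length Γ g⁻¹ ≤ length Γ g := by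
  obtain ⟨l, -, rfl, hl⟩ := exists_isReduced_spell_eq g
  rw [← spell_invRev, ← hl]
  exact (length_spell_le _).trans (by simp)

/-- The subgroup of `A(Γ)` generated by a set of vertices. -/
abbrev special (Γ : SimpleGraph V) (S : Set V) : Subgroup (Artin Γ) :=
  Subgroup.closure (gen Γ '' S)

theorem gen_mem_special {S : Set V} {v : V} (hv : v ∈ S) : gen Γ v ∈ special Γ S :=
  Subgroup.subset_closure (Set.mem_image_of_mem _ hv)

theorem special_mono {S T : Set V} (h : S ⊆ T) : special Γ S ≤ special Γ T :=
  Subgroup.closure_mono (Set.image_mono h)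

theorem spell_mem_special {S : Set V} {l : List (V × Bool)} (h : ∀ p ∈ l, p.1 ∈ S) :
    spell Γ l ∈ special Γ S := by
  induction l with
  | nil => rw [spell_nil]; exact one_mem _
  | cons p l ih =>
    rw [spell_cons]
    refine mul_mem ?_ (ih fun q hq => h q (List.mem_cons_of_mem _ hq))
    have hp := gen_mem_special (Γ := Γ) (h p List.mem_cons_self)
    obtain ⟨v, a⟩ := p
    rw [spell_singleton]
    split_ifs
    · exact hp
    · exact inv_mem hp

theorem mem_special_supp (g : Artin Γ) : g ∈ special Γ (supp Γ g) := by
  obtain ⟨l, hr, rfl, -⟩ := exists_isReduced_spell_eq g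
  exact spell_mem_special fun p hp => ⟨l, hr, rfl, p.2, hp⟩

theorem special_univ : special Γ Set.univ = ⊤ := by
  rw [special, Set.image_univ]
  exact PresentedGroup.closure_range_of _

/-! ### Images of generators -/

open scoped Classical in
/-- The retraction of `A(Γ)` onto the subgroup generated by `S`: vertices outside `S` are sent to
`1`. -/
noncomputable def retraction (Γ : SimpleGraph V) (S : Set V) : Artin Γ →* Artin Γ :=
  lift (fun v => if v ∈ S then gen Γ v else 1) fun v w h => by
    split_ifs <;> simp [commute_gen h]

theorem retraction_mem (S : Set V) (g : Artin Γ) : retraction Γ S g ∈ special Γ S := by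
  suffices h : (⊤ : Subgroup (Artin Γ)) ≤ (special Γ S).comap (retraction Γ S) from
    h (Subgroup.mem_top g)
  rw [← special_univ, special, Subgroup.closure_le]
  rintro _ ⟨v, -, rfl⟩
  simp only [SetLike.mem_coe, Subgroup.mem_comap, retraction, lift_gen]
  split_ifs with hv
  · exact gen_mem_special hv
  · exact one_mem _

open AdjoinLetter in
/-- An element that is spelled by vertices of `X ⊆ S ∪ {t}` and sent to the generator `t` by an
endomorphism fixing the generators in `S` contains `t` exactly once, provided that the neighbours of
`t` in `X` are central in the subgroup generated by `X`. Modulo these central letters, that subgroup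
is the free product of `⟨t⟩` with a subgroup of the one generated by `S`. -/
theorem exists_eq_mul_zpow_mul_of_map_eq_gen {S X : Set V} {t : V} (ht : t ∉ S)
    (hXS : X ⊆ insert t S)
    (hX : ∀ u ∈ X, Γ.Adj u t → ∀ v ∈ X, Commute (gen Γ u) (gen Γ v))
    {Ψ : Artin Γ →* Artin Γ} (hΨ : ∀ s ∈ S, Ψ (gen Γ s) = gen Γ s)
    {w : Artin Γ} (hw : w ∈ special Γ X) (hΨw : Ψ w = gen Γ t) :
    ∃ a ∈ special Γ S, ∃ b ∈ special Γ S, ∃ ε : ℤ, (ε = 1 ∨ ε = -1) ∧ w = a * gen Γ t ^ ε * b := by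
  classical
  -- `Z` consists of central letters; the other letters together with `t` generate a free product.
  set Z : Set V := {v ∈ X | Γ.Adj v t}
  set L : Set V := {v ∈ X | v ≠ t ∧ ¬ Γ.Adj v t}
  have hZS : Z ⊆ S := fun v hv => (hXS hv.1).resolve_left hv.2.ne
  have hLS : L ⊆ S := fun v hv => (hXS hv.1).resolve_left hv.2.1
  let κ : Artin Γ →* AdjoinLetter (Artin Γ) :=
    lift (fun v => if v = t then HNNExtension.t else if v ∈ L then HNNExtension.of (gen Γ v) else 1)
      fun v v' h => by
        split_ifs with h1 h2 h3 h4 h5 h6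
        · exact absurd (h1.trans h2.symm) h.ne
        · exact absurd (h1 ▸ h).symm h3.2.2
        · exact Commute.one_right _
        · exact absurd (h5 ▸ h) h4.2.2
        · exact (commute_gen h).map _
        all_goals simp
  let ι : AdjoinLetter (Artin Γ) →* Artin Γ := extend (retraction Γ L) (gen Γ t)
  have hκt : κ (gen Γ t) = HNNExtension.t := by simp [κ]
  have hκL : ∀ v ∈ L, κ (gen Γ v) = HNNExtension.of (gen Γ v) := fun v hv => by
    simp [κ, hv, hv.2.1]
  have hκ1 : ∀ v, v ≠ t → v ∉ L → κ (gen Γ v) = 1 := fun v hv hv' => by simp [κ, hv, hv']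
  have hικL : ∀ v ∈ L, ι (κ (gen Γ v)) = gen Γ v := fun v hv => by
    simp [hκL v hv, ι, retraction, hv]
  have hικt : ι (κ (gen Γ t)) = gen Γ t := by simp [hκt, ι]
  have hκZ : ∀ z ∈ special Γ Z, κ z = 1 := by
    intro z hz
    rw [← MonoidHom.mem_ker]
    refine (Subgroup.closure_le κ.ker).2 ?_ hz
    rintro _ ⟨v, hv, rfl⟩
    exact hκ1 v hv.2.ne fun h => h.2.2 hv.2
  have hcomm : ∀ z ∈ special Γ Z, ∀ x ∈ special Γ X, Commute z x := by
    intro z hz x hx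
    have hle : special Γ Z ≤ Subgroup.centralizer (special Γ X : Set (Artin Γ)) := by
      rw [special, Subgroup.centralizer_closure, Subgroup.closure_le]
      rintro _ ⟨u, hu, rfl⟩ _ ⟨v, hv, rfl⟩
      exact (hX u hu.1 hu.2 v hv).symm.eq
    exact (hle hz x hx).symm
  -- Removing the central letters changes an element by a central factor.
  have hfactor : ∀ x ∈ special Γ X, ι (κ x)⁻¹ * x ∈ special Γ Z := by
    intro x hx
    induction hx using Subgroup.closure_induction with
    | mem _ h =>
      obtain ⟨v, hv, rfl⟩ := h
      by_cases hvt : v = t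
      · subst hvt; rw [map_inv, hικt]; simp
      by_cases hvL : v ∈ L
      · rw [map_inv, hικL v hvL]; simp
      · rw [hκ1 v hvt hvL]
        simpa using gen_mem_special (S := Z) (v := v)
          (by exact ⟨hv, not_not.1 fun h => hvL ⟨hv, hvt, h⟩⟩)
    | one => simp
    | mul x y hx hy ihx ihy =>
      have := hcomm _ ihx y hy
      have h2 : ι (κ (x * y))⁻¹ * (x * y) = ι (κ y)⁻¹ * y * (ι (κ x)⁻¹ * x) := by
        rw [mul_assoc _ y, ← this.eq]
        simp [mul_assoc]
      rw [h2]
      exact mul_mem ihy ihx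
    | inv x hx ih =>
      have := hcomm _ ih x⁻¹ (inv_mem hx)
      have h2 : ι (κ x⁻¹)⁻¹ * x⁻¹ = (ι (κ x)⁻¹ * x)⁻¹ := by
        have h3 : ι (κ x⁻¹)⁻¹ * x⁻¹ = x * ((ι (κ x)⁻¹ * x)⁻¹ * x⁻¹) := by simp [mul_assoc]
        rw [h3, this.inv_left.eq, mul_inv_cancel_left]
      rw [h2]
      exact inv_mem ih
  have hcompat : (extend HNNExtension.of (κ (Ψ (gen Γ t)))).comp κ = (κ.comp Ψ).comp (ι.comp κ) := by
    refine hom_ext fun v => ?_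
    simp only [MonoidHom.comp_apply]
    by_cases hvt : v = t
    · subst hvt; rw [hικt, hκt, extend_t]
    by_cases hvL : v ∈ L
    · rw [hικL v hvL, hΨ v (hLS hvL), hκL v hvL, extend_of]
    · simp [hκ1 v hvt hvL]
  have hΨZ : ∀ z ∈ special Γ Z, Ψ z = z := by
    intro z hz
    refine MonoidHom.eqOn_closure (g := MonoidHom.id _) ?_ hz
    rintro _ ⟨v, hv, rfl⟩
    exact hΨ v (hZS hv)
  set z := ι (κ w)⁻¹ * w with hz
  have hzZ : z ∈ special Γ Z := hfactor w hw
  have hwz : w = ι (κ w) * z := by simp [hz]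
  have hkey : extend HNNExtension.of (κ (Ψ (gen Γ t))) (κ w) = HNNExtension.t := by
    have h1 := DFunLike.congr_fun hcompat w
    simp only [MonoidHom.comp_apply] at h1
    have h2 : Ψ (ι (κ w)) = gen Γ t * z⁻¹ := by
      rw [eq_mul_inv_iff_mul_eq, ← hΨw]
      conv_rhs => rw [hwz, map_mul, hΨZ z hzZ]
    rw [h1, h2, map_mul, hκt, hκZ _ (inv_mem hzZ), mul_one]
  obtain ⟨a, b, ε, hε, hab⟩ := exists_eq_of_mul_zpow_mul_of hkey
  refine ⟨retraction Γ L a, special_mono hLS (retraction_mem _ _), retraction Γ L b * z,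
    mul_mem (special_mono hLS (retraction_mem _ _)) (special_mono hZS hzZ), ε, hε, ?_⟩
  rw [hwz, hab]
  simp [ι, mul_assoc]

/-- If the subgroup generated by `S` lies in its image under `φ`, then a further generator `t` whose
image is spelled by `t` and vertices of `S` occurs exactly once in its image. -/
theorem exists_map_gen_eq {φ : MulAut (Artin Γ)} (hpure : IsPure Γ φ) (hsquare : IsSquare Γ φ)
    {S : Set V} (hS : special Γ S ≤ (special Γ S).map φ.toMonoidHom) {t : V} (ht : t ∉ S)
    (htS : supp Γ (φ (gen Γ t)) ⊆ insert t S) :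
    ∃ a ∈ special Γ S, ∃ b ∈ special Γ S, ∃ ε : ℤ, (ε = 1 ∨ ε = -1) ∧
      φ (gen Γ t) = a * gen Γ t ^ ε * b := by
  classical
  have hcomm : ∀ u, Γ.Adj u t → Commute (φ (gen Γ u)) (gen Γ t) := by
    intro u hu
    have hle : special Γ (supp Γ (φ (gen Γ u))) ≤ Subgroup.centralizer {gen Γ t} := by
      rw [special, Subgroup.closure_le]
      rintro _ ⟨v, hv, rfl⟩
      exact Subgroup.mem_centralizer_singleton_iff.2 (hsquare u t hu v hv t (hpure t)).eq
    exact Subgroup.mem_centralizer_singleton_iff.1 (hle (mem_special_supp _))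
  -- `σ` agrees with `φ` on `S` and fixes `t`, so that `σ ∘ φ⁻¹` fixes `S` and sends `φ t` to `t`.
  let σ : Artin Γ →* Artin Γ :=
    lift (fun v => if v = t then gen Γ t else if v ∈ S then φ (gen Γ v) else 1) fun v v' h => by
      split_ifs with h1 h2 h3 h4 h5 h6
      · exact Commute.refl _
      · exact (hcomm v' (h1 ▸ h).symm).symm
      · exact Commute.one_right _
      · exact hcomm v (h5 ▸ h)
      · exact (commute_gen h).map φ
      all_goals simp
  have hσ : ∀ x ∈ special Γ S, σ x = φ x := by
    intro x hx
    refine MonoidHom.eqOn_closure (g := φ.toMonoidHom) ?_ hx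
    rintro _ ⟨v, hv, rfl⟩
    have : v ≠ t := fun h => ht (h ▸ hv)
    simp [σ, this, hv]
  refine exists_eq_mul_zpow_mul_of_map_eq_gen (X := supp Γ (φ (gen Γ t)))
    (Ψ := σ.comp φ.symm.toMonoidHom) ht htS ?_ ?_ (mem_special_supp _) ?_
  · exact fun u _ hut v hv => hsquare u t hut u (hpure u) v hv
  · intro s hs
    obtain ⟨x, hx, hxs⟩ := hS (gen_mem_special hs)
    have hxs : φ x = gen Γ s := hxs
    simp [← hxs, hσ x hx]
  · simp [σ]

/-! ### The terminal partition -/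

theorem below_subset_succ (D : Digraph V) (i : ℕ) : below D i ⊆ below D (i + 1) :=
  Set.subset_union_left

theorem supp_subset_of_mem_level {φ : MulAut (Artin Γ)} {i : ℕ} {s : V}
    (hs : s ∈ level (diagram Γ φ) i) :
    supp Γ (φ (gen Γ s)) ⊆ insert s (below (diagram Γ φ) i) := by
  intro v hv
  by_contra h
  rw [Set.mem_insert_iff, not_or] at h
  exact hs.2 v h.2 ⟨Ne.symm h.1, hv⟩

theorem level_nonempty [Finite V] {D : Digraph V} (hD : NoCycle D) {i : ℕ}
    (hi : below D i ≠ Set.univ) : (level D i).Nonempty := by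
  have hirr : Std.Irrefl (Relation.TransGen (flip D.Adj)) :=
    ⟨fun s hs => hD s (Relation.transGen_swap.1 hs)⟩
  have hwf : WellFounded (Relation.TransGen (flip D.Adj)) :=
    Finite.wellFounded_of_trans_of_irrefl _
  obtain ⟨s, hs, hmin⟩ := hwf.has_min (below D i)ᶜ (Set.nonempty_compl.2 hi)
  exact ⟨s, hs, fun t ht hst => hmin t ht (.single hst)⟩

theorem exists_below_eq_univ [Finite V] {D : Digraph V} (hD : NoCycle D) :
    ∃ k, below D (k + 1) = Set.univ := by
  have key : ∀ i, below D i = Set.univ ∨ i ≤ (below D i).ncard := by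
    intro i
    induction i with
    | zero => exact Or.inr (Nat.zero_le _)
    | succ i ih =>
      by_cases h : below D i = Set.univ
      · exact Or.inl (Set.univ_subset_iff.1 (h ▸ below_subset_succ D i))
      · right
        obtain ⟨s, hs⟩ := level_nonempty hD h
        have : below D i ⊂ below D (i + 1) :=
          (Set.ssubset_iff_of_subset (below_subset_succ D i)).2 ⟨s, Or.inr hs, hs.1⟩
        have := Set.ncard_lt_ncard this (Set.toFinite _)
        have := ih.resolve_left h
        omega
  refine ⟨Nat.card V, (key _).resolve_right fun h => ?_⟩
  have := Set.ncard_le_ncard (Set.subset_univ (below D (Nat.card V + 1)))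
  rw [Set.ncard_univ] at this
  omega

theorem below_height_succ [Finite V] {D : Digraph V} (hD : NoCycle D) :
    below D (height D + 1) = Set.univ :=
  Nat.sInf_mem (s := {k : ℕ | below D (k + 1) = Set.univ}) (exists_below_eq_univ hD)

/-- The subgroups of the terminal filtration are contained in their images, because a generator of
one level occurs exactly once in its image, among generators of lower levels. -/
theorem special_below_le_map {φ : MulAut (Artin Γ)} (hpure : IsPure Γ φ) (hsquare : IsSquare Γ φ)
    (i : ℕ) : special Γ (below (diagram Γ φ) i) ≤
      (special Γ (below (diagram Γ φ) i)).map φ.toMonoidHom := by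
  induction i with
  | zero => simp [special, below]
  | succ i ih =>
    have hmono := special_mono (Γ := Γ) (below_subset_succ (diagram Γ φ) i)
    have hle := ih.trans (Subgroup.map_mono (f := φ.toMonoidHom) hmono)
    conv_lhs => rw [special]
    rw [Subgroup.closure_le]
    rintro _ ⟨v, hv | hv, rfl⟩
    · exact hle (gen_mem_special hv)
    · obtain ⟨a, ha, b, hb, ε, hε, h⟩ :=
        exists_map_gen_eq hpure hsquare ih hv.1 (supp_subset_of_mem_level hv)
      have hφ : φ (gen Γ v) ∈ (special Γ (below (diagram Γ φ) (i + 1))).map φ.toMonoidHom :=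
        Subgroup.mem_map_of_mem φ.toMonoidHom (gen_mem_special (Or.inr hv))
      have hmem := mul_mem (mul_mem (inv_mem (hle ha)) hφ) (inv_mem (hle hb))
      have heq : a⁻¹ * φ (gen Γ v) * b⁻¹ = gen Γ v ^ ε := by rw [h]; group
      rw [heq] at hmem
      rcases hε with rfl | rfl
      · simpa using hmem
      · simpa using inv_mem hmem

theorem exists_map_gen_eq_of_mem_level {φ : MulAut (Artin Γ)} (hpure : IsPure Γ φ)
    (hsquare : IsSquare Γ φ) {i : ℕ} {s : V} (hs : s ∈ level (diagram Γ φ) i) :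
    ∃ a ∈ lower Γ (diagram Γ φ) i, ∃ b ∈ lower Γ (diagram Γ φ) i,
      ∃ ε : ℤ, (ε = 1 ∨ ε = -1) ∧ φ (gen Γ s) = a * gen Γ s ^ ε * b :=
  exists_map_gen_eq hpure hsquare (special_below_le_map hpure hsquare i) hs.1
    (supp_subset_of_mem_level hs)

/-! ### Growth -/

/-- The growth allowed to the subgroup generated by the first `i` levels: none for `i = 0`, where
the subgroup is trivial, and of degree `i - 1` otherwise. -/
def growthBound : ℕ → ℕ → ℕ
  | 0, _ => 0
  | i + 1, n => (n + 1) ^ i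

theorem growthBound_mono (i : ℕ) : Monotone (growthBound i) := by
  cases i with
  | zero => exact monotone_const
  | succ i => exact fun m n h => Nat.pow_le_pow_left (by omega) i

theorem one_le_growthBound_succ (i n : ℕ) : 1 ≤ growthBound (i + 1) n :=
  Nat.one_le_pow _ _ (Nat.succ_pos n)

theorem mul_growthBound_le (i n : ℕ) : n * growthBound i n ≤ growthBound (i + 1) n := by
  cases i with
  | zero => simp [growthBound]
  | succ i =>
    rw [growthBound, growthBound, pow_succ']
    exact Nat.mul_le_mul_right _ (Nat.le_succ n)

/-- The subgroup of the elements `g` with `|φⁿ g| ≤ C * b n` for all `n`, where `C` may depend on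
`g`. -/
def boundedBy (Γ : SimpleGraph V) (φ : MulAut (Artin Γ)) (b : ℕ → ℕ) : Subgroup (Artin Γ) where
  carrier := {g | ∃ C : ℕ, ∀ n : ℕ, length Γ ((φ ^ n) g) ≤ C * b n}
  one_mem' := ⟨0, fun n => by simp [length_one]⟩
  mul_mem' := by
    rintro g h ⟨C, hC⟩ ⟨C', hC'⟩
    refine ⟨C + C', fun n => ?_⟩
    rw [map_mul, add_mul]
    exact (length_mul_le _ _).trans (add_le_add (hC n) (hC' n))
  inv_mem' := by
    rintro g ⟨C, hC⟩
    refine ⟨C, fun n => ?_⟩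
    rw [map_inv]
    exact (length_inv_le _).trans (hC n)

theorem special_below_le_boundedBy {φ : MulAut (Artin Γ)} (hpure : IsPure Γ φ)
    (hsquare : IsSquare Γ φ) (i : ℕ) :
    special Γ (below (diagram Γ φ) i) ≤ boundedBy Γ φ (growthBound i) := by
  induction i with
  | zero => simp [special, below]
  | succ i ih =>
    rw [special, Subgroup.closure_le]
    have key : ∀ s, ∀ C, (∀ n, length Γ ((φ ^ n) (gen Γ s)) ≤ 1 + n * (C * growthBound i n)) →
        gen Γ s ∈ boundedBy Γ φ (growthBound (i + 1)) := by
      intro s C hC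
      refine ⟨1 + C, fun n => (hC n).trans ?_⟩
      have h1 := one_le_growthBound_succ i n
      have h2 := Nat.mul_le_mul_left C (mul_growthBound_le i n)
      linarith
    rintro _ ⟨s, hs | hs, rfl⟩
    · obtain ⟨C, hC⟩ := ih (gen_mem_special hs)
      refine key s C fun n => ?_
      rcases Nat.eq_zero_or_pos n with rfl | hn
      · simpa using length_gen_le s
      · exact (hC n).trans ((Nat.le_mul_of_pos_left _ hn).trans (Nat.le_add_left _ _))
    · obtain ⟨a, ha, b, hb, ε, hε, h⟩ := exists_map_gen_eq_of_mem_level hpure hsquare hs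
      obtain ⟨A, hA⟩ := ih ha
      obtain ⟨B, hB⟩ := ih hb
      refine key s (A + B) fun n => ?_
      -- Each application of `φ` adds at most the lengths of the images of `a` and `b`.
      induction n with
      | zero => simpa using length_gen_le s
      | succ n ihn =>
        have hε' : length Γ ((φ ^ n) (gen Γ s) ^ ε) ≤ length Γ ((φ ^ n) (gen Γ s)) := by
          rcases hε with rfl | rfl
          · simp
          · simpa using length_inv_le ((φ ^ n) (gen Γ s))
        have h1 : length Γ ((φ ^ (n + 1)) (gen Γ s)) ≤ length Γ ((φ ^ n) a) +
            length Γ ((φ ^ n) (gen Γ s)) + length Γ ((φ ^ n) b) := by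
          rw [pow_succ, MulAut.mul_apply, h, map_mul, map_mul, map_zpow]
          have := length_mul_le ((φ ^ n) a) ((φ ^ n) (gen Γ s) ^ ε)
          have := length_mul_le ((φ ^ n) a * (φ ^ n) (gen Γ s) ^ ε) ((φ ^ n) b)
          omega
        have h2 := Nat.mul_le_mul_left ((n + 1) * (A + B))
          (growthBound_mono i (Nat.le_succ n))
        have h3 := hA n
        have h4 := hB n
        linarith

theorem exists_length_pow_le [Finite V] {φ : MulAut (Artin Γ)} (hpure : IsPure Γ φ)
    (hsquare : IsSquare Γ φ) (hcycle : NoCycle (diagram Γ φ)) (w : Artin Γ) :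
    ∃ C : ℕ, ∀ n : ℕ, length Γ ((φ ^ n) w) ≤ C * (n + 1) ^ height (diagram Γ φ) := by
  have h := special_below_le_boundedBy hpure hsquare (height (diagram Γ φ) + 1)
  rw [below_height_succ hcycle, special_univ] at h
  exact h (Subgroup.mem_top w)

theorem hasDilatationAt_zero {φ : MulAut (Artin Γ)} {w : Artin Γ} {C d : ℕ}
    (h : ∀ n : ℕ, length Γ ((φ ^ n) w) ≤ C * (n + 1) ^ d) : HasDilatationAt Γ φ w 0 := by
  have hlog : Tendsto (fun k : ℕ => Real.log ((k : ℝ) + 1) / k) atTop (𝓝 0) := by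
    have := (Real.tendsto_pow_log_div_mul_add_atTop 1 (-1) 1 one_ne_zero).comp
      (tendsto_atTop_add_const_right atTop (1 : ℝ) tendsto_natCast_atTop_atTop)
    simpa [Function.comp_def] using this
  have hbound : Tendsto (fun k : ℕ => Real.log ((C : ℝ) + 1) / k +
      d * (Real.log ((k : ℝ) + 1) / k)) atTop (𝓝 0) := by
    simpa using (tendsto_const_div_atTop_nhds_zero_nat (Real.log ((C : ℝ) + 1))).add
      (hlog.const_mul (d : ℝ))
  refine squeeze_zero (fun k => ?_) (fun k => ?_) hbound
  · exact div_nonneg (Real.log_natCast_nonneg _) (Nat.cast_nonneg k)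
  · rw [← mul_div_assoc, ← add_div]
    refine div_le_div_of_nonneg_right ?_ (Nat.cast_nonneg k)
    rw [← Real.log_pow, ← Real.log_mul (by positivity) (by positivity)]
    rcases Nat.eq_zero_or_pos (length Γ ((φ ^ k) w)) with h0 | h0
    · -- The trivial element: `Real.log 0 = 0`.
      rw [h0, Nat.cast_zero, Real.log_zero]
      exact_mod_cast Real.log_natCast_nonneg ((C + 1) * (k + 1) ^ d)
    · refine Real.log_le_log (by exact_mod_cast h0) ?_
      have := (h k).trans (Nat.mul_le_mul_right _ (Nat.le_succ C))
      exact_mod_cast this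

end RAAG

theorem theorem4p1 {V : Type*} [Finite V] (Γ : SimpleGraph V) (φ : MulAut (RAAG.Artin Γ))
    (hpure : RAAG.IsPure Γ φ) (hsquare : RAAG.IsSquare Γ φ)
    (hcycle : RAAG.NoCycle (RAAG.diagram Γ φ)) :
    -- the terminal partition exhausts the vertices, so its height is defined
    (∃ k : ℕ, RAAG.below (RAAG.diagram Γ φ) (k + 1) = Set.univ) ∧
    -- the map is polynomially growing
    (Nonempty V → RAAG.IsPolynomiallyGrowing Γ φ) ∧
    -- one polynomial, of degree at most the height, bounds the growth of all words
    (∃ p : Polynomial ℝ, p.natDegree ≤ RAAG.height (RAAG.diagram Γ φ) ∧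
      ∀ w : RAAG.Artin Γ, ∃ C : ℝ, 0 < C ∧
        ∀ n : ℕ, (RAAG.length Γ ((φ ^ n) w) : ℝ) ≤ C * p.eval (n : ℝ)) ∧
    -- the form of the images of the generators
    (∀ (i : ℕ) (s : V), s ∈ RAAG.level (RAAG.diagram Γ φ) i →
      ∃ t₀ ∈ RAAG.lower Γ (RAAG.diagram Γ φ) i, ∃ t₁ ∈ RAAG.lower Γ (RAAG.diagram Γ φ) i,
        ∃ ε : ℤ, (ε = 1 ∨ ε = -1) ∧
          φ (RAAG.gen Γ s) = t₀ * RAAG.gen Γ s ^ ε * t₁) := by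
  set d := RAAG.height (RAAG.diagram Γ φ)
  have hgrowth : ∀ w : RAAG.Artin Γ, ∃ C : ℝ, 0 < C ∧ ∀ n : ℕ,
      (RAAG.length Γ ((φ ^ n) w) : ℝ) ≤
        C * ((Polynomial.X + 1) ^ d : Polynomial ℝ).eval (n : ℝ) := by
    intro w
    obtain ⟨C, hC⟩ := RAAG.exists_length_pow_le hpure hsquare hcycle w
    refine ⟨C + 1, by positivity, fun n => ?_⟩
    have := (hC n).trans (Nat.mul_le_mul_right _ (Nat.le_succ C))
    simp only [Polynomial.eval_pow, Polynomial.eval_add, Polynomial.eval_X, Polynomial.eval_one]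
    exact_mod_cast this
  have hdil : ∀ w, RAAG.HasDilatationAt Γ φ w 0 := fun w =>
    let ⟨_, hC⟩ := RAAG.exists_length_pow_le hpure hsquare hcycle w
    RAAG.hasDilatationAt_zero hC
  refine ⟨RAAG.exists_below_eq_univ hcycle, ?_, ⟨(Polynomial.X + 1) ^ d, ?_, hgrowth⟩,
    fun i s hs => RAAG.exists_map_gen_eq_of_mem_level hpure hsquare hs⟩
  · rintro ⟨s⟩
    obtain ⟨C, -, hC⟩ := hgrowth (RAAG.gen Γ s)
    exact ⟨s, ⟨0, hdil _, fun w => ⟨0, le_rfl, hdil w⟩⟩, 0, C, _, fun n _ => hC n⟩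
  · rw [← Polynomial.C_1, Polynomial.natDegree_pow, Polynomial.natDegree_X_add_C, mul_one]
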